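/- Let $R$ be a commutative noetherian local ring and let $M$ be a finitely generated $R$-module. A homomorphism $f\colon X\to Y$ of finitely generated $R$-modules is called irreducible if it is neither a split monomorphism nor a split epimorphism and if, for every factorization $X\xrightarrow{g}L\xrightarrow{h}Y$ of $f$ through a finitely generated $R$-module $L$, either $g$ is a split monomorphism or $h$ is a split epimorphism. Suppose that, for some positive integer $m$, there is an irreducible epimorphism $R^{\oplus m}\to M$. If the injective dimension of $M$ over $R$ is finite, $\operatorname{id}_R M<\infty$, then $R$ is a field. -/

import Mathlib

universe u

section IrreducibleHom

variable {R : Type u} [CommRing R] {M N : Type u} [AddCommGroup M] [Module R M]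
  [AddCommGroup N] [Module R N]

/-- A split monomorphism: a homomorphism with a left inverse. -/
def IsSplitMonoHom (f : M →ₗ[R] N) : Prop :=
  ∃ r : N →ₗ[R] M, r.comp f = LinearMap.id

/-- A split epimorphism: a homomorphism with a right inverse. -/
def IsSplitEpiHom (f : M →ₗ[R] N) : Prop :=
  ∃ s : N →ₗ[R] M, f.comp s = LinearMap.id

/-- An irreducible homomorphism in the category of finitely generated `R`-modules: it is neither
a split monomorphism nor a split epimorphism, and in every factorization `f = h ∘ g` through a
finitely generated module `L`, either `g` is a split monomorphism or `h` is a split epimorphism. -/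
structure IsIrreducibleHom (f : M →ₗ[R] N) : Prop where
  not_splitMono : ¬ IsSplitMonoHom f
  not_splitEpi : ¬ IsSplitEpiHom f
  factor : ∀ (L : Type u) [AddCommGroup L] [Module R L] [Module.Finite R L]
    (g : M →ₗ[R] L) (h : L →ₗ[R] N), h.comp g = f → IsSplitMonoHom g ∨ IsSplitEpiHom h

end IrreducibleHom

/-!
Let `φ : R^m → M` be an irreducible epimorphism with kernel `K`, let `𝔪` be the maximal ideal
and `k = R ⧸ 𝔪`.

*The kernel is simple.* If some `x ∈ K` had a unit coordinate, `φ` would factor through the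
projection of `R^m` along `x`, which is impossible; so `K ≤ 𝔪 • R^m`
(`IsIrreducibleHom.ker_le_maximalIdeal_smul_top`). For `0 ≠ N ≤ K` the map `R^m → R^m ⧸ N` is not
injective, hence `R^m ⧸ N → M` has a section; modulo `𝔪` this section is onto, so it is onto by
Nakayama's lemma and `N = K` (`IsIrreducibleHom.ker_le_of_le_ker`). Thus `0 → k → R^m → M → 0` is
exact.

*Finite injective dimension forces `Ext^i(N, M) = 0` for all finitely generated `N` and `i ≥ 1`.*
This is a descending induction on `i`. Suppose `Ext^{i+1}(-, M)` vanishes on finitely generated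
modules. By a prime filtration it is enough to treat `N = R ⧸ p`. If `p ≠ 𝔪`, any
`x ∈ 𝔪 \ p` acts surjectively on `Ext^i(R ⧸ p, M)`, which is zero by Nakayama's lemma
(`subsingleton_ext_quotient_prime`). If `p = 𝔪`, the sequence above presents `Ext^i(k, M)` as a
quotient of `Ext^i(R^m, M) = 0` (`subsingleton_ext_of_subsingleton_ext_succ`).

*Counting lengths.* Now `Hom(-, M)` is exact on finitely generated modules. It vanishes on `R ⧸ p`
for `p ≠ 𝔪`, so `M = Hom(R, M)` has finite length, and then so does `R`. Over the Artinian ring `R`,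
exactness gives `length Hom(N, M) = length N * r` with `r = length Hom(k, M)`
(`length_linearMap_eq_mul`), in particular `length M = length R * r`. As `K` is simple,
`m * length R = 1 + length R * r`, so `length R` divides `1` and `R` is a field.

Epimorphisms onto vector spaces split, so the result amounts to saying that the target of an
irreducible epimorphism from `R^m` never has finite injective dimension.
-/

open CategoryTheory Abelian IsLocalRing

/-! ### The kernel of an irreducible epimorphism from a free module -/

section Kernel

variable {R : Type u} [CommRing R] [IsLocalRing R] {M : Type u} [AddCommGroup M] [Module R M]
  {m : ℕ} {φ : (Fin m → R) →ₗ[R] M}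

theorem IsIrreducibleHom.ker_le_maximalIdeal_smul_top (hirr : IsIrreducibleHom φ) :
    LinearMap.ker φ ≤ maximalIdeal R • (⊤ : Submodule R (Fin m → R)) := by
  intro x hx
  have hcoord : ∀ i, x i ∈ maximalIdeal R := by
    intro i
    by_contra hi
    obtain ⟨u, hu⟩ : IsUnit (x i) := by simpa using hi
    -- `P` is the projection along `x` onto the vectors whose `i`-th coordinate vanishes.
    let P : (Fin m → R) →ₗ[R] (Fin m → R) :=
      LinearMap.id - ((↑u⁻¹ : R) • LinearMap.proj i).smulRight x
    have hPx : P x = 0 := by simp [P, ← hu]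
    have hφP : φ.comp P = φ := by
      ext1 j
      ext
      simp [P, LinearMap.mem_ker.mp hx]
    rcases hirr.factor _ P φ hφP with ⟨r, hr⟩ | h
    · have hx0 : x = 0 := by
        rw [← LinearMap.id_apply (R := R) x, ← hr, LinearMap.comp_apply, hPx, map_zero]
      exact u.ne_zero (by simp [hu, hx0])
    · exact hirr.not_splitEpi h
  rw [pi_eq_sum_univ' x]
  exact Submodule.sum_mem _ fun i _ ↦
    Submodule.smul_mem_smul (hcoord i) Submodule.mem_top

/-- The kernel has no nonzero proper submodule. The dichotomy in the definition of irreducibility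
is applied to `R^m → R^m ⧸ N → M`, whose second map is shown to be injective. -/
theorem IsIrreducibleHom.ker_le_of_le_ker (hirr : IsIrreducibleHom φ)
    {N : Submodule R (Fin m → R)} (hN : N ≤ LinearMap.ker φ) (hN0 : N ≠ ⊥) :
    LinearMap.ker φ ≤ N := by
  rcases hirr.factor _ N.mkQ (N.liftQ φ hN) (N.liftQ_mkQ φ hN) with ⟨r, hr⟩ | ⟨s, hs⟩
  · refine absurd ?_ hN0
    rw [← N.ker_mkQ]
    exact LinearMap.ker_eq_bot_of_inverse hr
  · have hsφ : ∀ y, N.liftQ φ hN (s y) = y := fun y ↦ LinearMap.congr_fun hs y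
    -- The section `s` is surjective: its image together with that of `ker φ ≤ 𝔪 • R^m`
    -- generates `R^m ⧸ N`.
    have htop : (⊤ : Submodule R (Fin m → R)) ≤ (LinearMap.range s).comap N.mkQ := by
      refine Submodule.le_of_le_smul_of_le_jacobson_bot Module.Finite.fg_top
        (maximalIdeal_le_jacobson ⊥) fun v _ ↦ ?_
      obtain ⟨w, hw⟩ := N.mkQ_surjective (s (φ v))
      have hwv : v - w ∈ LinearMap.ker φ := by
        have h := hsφ (φ v)
        rw [← hw, Submodule.mkQ_apply, Submodule.liftQ_apply] at h
        simp [h]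
      rw [← add_sub_cancel w v]
      exact Submodule.add_mem_sup ⟨φ v, hw.symm⟩ (hirr.ker_le_maximalIdeal_smul_top hwv)
    intro v hv
    obtain ⟨y, hy⟩ := htop (Submodule.mem_top (x := v))
    have hy0 : y = 0 := by
      rw [← hsφ y, hy]
      simpa using hv
    rw [← N.ker_mkQ, LinearMap.mem_ker, ← hy, hy0, map_zero]

theorem IsIrreducibleHom.isSimpleModule_ker (hirr : IsIrreducibleHom φ)
    (hsurj : Function.Surjective φ) : IsSimpleModule R (LinearMap.ker φ) := by
  rw [isSimpleModule_iff_isAtom]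
  refine ⟨fun h ↦ hirr.not_splitMono ?_, fun N hN ↦ ?_⟩
  · let e := LinearEquiv.ofBijective φ ⟨LinearMap.ker_eq_bot.mp h, hsurj⟩
    exact ⟨e.symm, LinearMap.ext e.symm_apply_apply⟩
  · by_contra hN0
    exact hN.not_ge (hirr.ker_le_of_le_ker hN.le hN0)

end Kernel

/-! ### Vanishing of Ext -/

section ExtVanishing

variable {R : Type u} [CommRing R] {M : Type u} [AddCommGroup M] [Module R M]

theorem CategoryTheory.ShortComplex.ShortExact.subsingleton_ext_X₂
    {S : ShortComplex (ModuleCat.{u} R)} (hS : S.ShortExact) (Y : ModuleCat.{u} R) (i : ℕ)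
    (h₁ : Subsingleton (Ext S.X₁ Y i)) (h₃ : Subsingleton (Ext S.X₃ Y i)) :
    Subsingleton (Ext S.X₂ Y i) := by
  refine subsingleton_of_forall_eq 0 fun α ↦ ?_
  obtain ⟨β, rfl⟩ := Ext.contravariant_sequence_exact₂ hS Y α (Subsingleton.elim _ _)
  rw [Subsingleton.elim β 0, Ext.comp_zero]

theorem ModuleCat.shortExact_of_exact {A B C : Type u} [AddCommGroup A] [Module R A]
    [AddCommGroup B] [Module R B] [AddCommGroup C] [Module R C] (f : A →ₗ[R] B) (g : B →ₗ[R] C)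
    (hf : Function.Injective f) (hg : Function.Surjective g) (hfg : Function.Exact f g) :
    (ShortComplex.mk (ModuleCat.ofHom f) (ModuleCat.ofHom g)
      (by rw [← ModuleCat.ofHom_comp, hfg.linearMap_comp_eq_zero]; rfl)).ShortExact where
  exact := by
    rw [ShortComplex.ShortExact.moduleCat_exact_iff_function_exact]
    exact hfg
  mono_f := (ModuleCat.mono_iff_injective _).mpr hf
  epi_g := (ModuleCat.epi_iff_surjective _).mpr hg

variable [IsLocalRing R] [IsNoetherianRing R] [Module.Finite R M]

/-- Multiplication by some `x ∈ 𝔪 \ p` is injective on `R ⧸ p`, and the vanishing of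
`Ext^{i+1}` on its cokernel makes it surjective on the finitely generated module
`Ext^i(R ⧸ p, M)`. For `i = 0` this says `Hom(R ⧸ p, M) = 0`. -/
theorem subsingleton_ext_quotient_prime (i : ℕ)
    (hvan : ∀ (N : Type u) [AddCommGroup N] [Module R N] [Module.Finite R N],
      Subsingleton (Ext (ModuleCat.of R N) (ModuleCat.of R M) (i + 1)))
    {N : Type u} [AddCommGroup N] [Module R N] [Module.Finite R N]
    (p : Ideal R) [p.IsPrime] (hp : p ≠ maximalIdeal R) (e : N ≃ₗ[R] R ⧸ p) :
    Subsingleton (Ext (ModuleCat.of R N) (ModuleCat.of R M) i) := by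
  obtain ⟨x, hxm, hxp⟩ := SetLike.exists_of_lt
    ((le_maximalIdeal (Ideal.IsPrime.ne_top ‹p.IsPrime›)).lt_of_ne hp)
  let f : N →ₗ[R] N := LinearMap.lsmul R N x
  have hf : Function.Injective f := by
    rw [← LinearMap.ker_eq_bot, LinearMap.ker_eq_bot']
    intro n hn
    have hn' : x • e n = 0 := by
      rw [← map_smul, show x • n = 0 from hn, map_zero]
    obtain ⟨r, hr⟩ := Ideal.Quotient.mk_surjective (e n)
    rw [← hr, ← Ideal.Quotient.mk_eq_mk, ← Submodule.Quotient.mk_smul] at hn'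
    have := Ideal.Quotient.eq_zero_iff_mem.mp hn'
    rw [← e.map_eq_zero_iff, ← hr, Ideal.Quotient.eq_zero_iff_mem]
    exact (Ideal.IsPrime.mem_or_mem ‹_› this).resolve_left hxp
  have hS := ModuleCat.shortExact_of_exact f (LinearMap.range f).mkQ hf
    (Submodule.mkQ_surjective _) (LinearMap.exact_map_mkQ_range f)
  have htop : (⊤ : Submodule R (Ext (ModuleCat.of R N) (ModuleCat.of R M) i)) ≤
      maximalIdeal R • ⊤ := by
    intro α _
    have := hvan (N ⧸ LinearMap.range f)
    obtain ⟨β, hβ⟩ := Ext.contravariant_sequence_exact₁ hS (ModuleCat.of R M) α (add_comm 1 i)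
      (this.elim _ _)
    have hmul : x • β = α := by
      have hfx : ModuleCat.ofHom f = x • 𝟙 (ModuleCat.of R N) := rfl
      rw [← hβ]
      simp [hfx, Ext.mk₀_smul]
    rw [← hmul]
    exact Submodule.smul_mem_smul hxm Submodule.mem_top
  have hbot := Submodule.eq_bot_of_le_smul_of_le_jacobson_bot (maximalIdeal R) _
    Module.Finite.fg_top htop (maximalIdeal_le_jacobson ⊥)
  exact (Submodule.subsingleton_iff R).mp (subsingleton_of_bot_eq_top hbot.symm)

/-- The step of the descending induction. The simple kernel of `φ` is a copy of the residue field
embedded in a free module, and this plays the role of the assumption `depth R = 0`. -/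
theorem subsingleton_ext_of_subsingleton_ext_succ {m : ℕ} {φ : (Fin m → R) →ₗ[R] M}
    (hsurj : Function.Surjective φ) [IsSimpleModule R (LinearMap.ker φ)] (i : ℕ)
    (hvan : ∀ (N : Type u) [AddCommGroup N] [Module R N] [Module.Finite R N],
      Subsingleton (Ext (ModuleCat.of R N) (ModuleCat.of R M) (i + 2)))
    (N : Type u) [AddCommGroup N] [Module R N] [Module.Finite R N] :
    Subsingleton (Ext (ModuleCat.of R N) (ModuleCat.of R M) (i + 1)) := by
  have hker : Subsingleton
      (Ext (ModuleCat.of R (LinearMap.ker φ)) (ModuleCat.of R M) (i + 1)) := by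
    have hS := ModuleCat.shortExact_of_exact (LinearMap.ker φ).subtype φ
      (Submodule.injective_subtype _) hsurj (LinearMap.exact_subtype_ker_map φ)
    refine subsingleton_of_forall_eq 0 fun α ↦ ?_
    have := hvan M
    obtain ⟨β, rfl⟩ := Ext.contravariant_sequence_exact₁ hS (ModuleCat.of R M) α
      (add_comm 1 (i + 1)) (this.elim _ _)
    have hβ : β = 0 := Ext.eq_zero_of_projective (P := ModuleCat.of R (Fin m → R)) β
    rw [hβ, Ext.comp_zero]
  induction ‹Module.Finite R N› using
    IsNoetherianRing.induction_on_isQuotientEquivQuotientPrime R with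
  | subsingleton N =>
    refine subsingleton_of_forall_eq 0 fun α ↦ ?_
    have hN : Limits.IsZero (ModuleCat.of R N) := ModuleCat.isZero_of_subsingleton _
    rw [← α.mk₀_id_comp, hN.eq_zero_of_src (𝟙 _), Ext.mk₀_zero, Ext.zero_comp]
  | quotient N p e =>
    by_cases hp : p.1 = maximalIdeal R
    · -- Here `N` is isomorphic to `ker φ`; the isomorphism is read as a short exact sequence.
      obtain ⟨I, hI, ⟨e'⟩⟩ := isSimpleModule_iff_quot_maximal.mp
        ‹IsSimpleModule R (LinearMap.ker φ)›
      rw [eq_maximalIdeal hI, ← hp] at e'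
      let E : N ≃ₗ[R] LinearMap.ker φ := e.trans e'.symm
      have hS := ModuleCat.shortExact_of_exact E.toLinearMap (0 : _ →ₗ[R] PUnit.{u + 1})
        E.injective (Function.surjective_to_subsingleton _)
        ((E.toLinearMap.exact_zero_iff_surjective _).2 E.surjective)
      refine subsingleton_of_forall_eq 0 fun α ↦ ?_
      have := hvan PUnit.{u + 1}
      obtain ⟨β, rfl⟩ := Ext.contravariant_sequence_exact₁ hS (ModuleCat.of R M) α
        (add_comm 1 (i + 1)) (this.elim _ _)
      rw [hker.elim β 0, Ext.comp_zero]
    · exact subsingleton_ext_quotient_prime (i + 1) hvan p.1 hp e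
  | exact N₁ N₂ N₃ f g hf hg hfg h₁ h₃ =>
    exact (ModuleCat.shortExact_of_exact f g hf hg hfg).subsingleton_ext_X₂ _ _ h₁ h₃

theorem subsingleton_ext_succ_of_hasInjectiveDimensionLT {m : ℕ} {φ : (Fin m → R) →ₗ[R] M}
    (hsurj : Function.Surjective φ) [IsSimpleModule R (LinearMap.ker φ)] (n : ℕ)
    (hn : HasInjectiveDimensionLT (ModuleCat.of R M) n) (i : ℕ)
    (N : Type u) [AddCommGroup N] [Module R N] [Module.Finite R N] :
    Subsingleton (Ext (ModuleCat.of R N) (ModuleCat.of R M) (i + 1)) := by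
  by_cases hi : n ≤ i + 1
  · exact hn.subsingleton _ _ _ hi _
  · refine subsingleton_ext_of_subsingleton_ext_succ hsurj i (fun N _ _ _ ↦ ?_) N
    exact subsingleton_ext_succ_of_hasInjectiveDimensionLT hsurj n hn (i + 1) N
termination_by n - i

end ExtVanishing

/-! ### Lengths of Hom modules -/

section Length

variable {R : Type u} [CommRing R] {M : Type u} [AddCommGroup M] [Module R M]

/-- Vanishing of `Ext^1` makes `Hom(-, M)` exact, hence lengths of Hom modules additive. -/
theorem length_linearMap_eq_add
    (hvan : ∀ (N : Type u) [AddCommGroup N] [Module R N] [Module.Finite R N],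
      Subsingleton (Ext (ModuleCat.of R N) (ModuleCat.of R M) 1))
    {N₁ N₂ N₃ : Type u} [AddCommGroup N₁] [Module R N₁] [AddCommGroup N₂] [Module R N₂]
    [AddCommGroup N₃] [Module R N₃] [Module.Finite R N₃] (f : N₁ →ₗ[R] N₂) (g : N₂ →ₗ[R] N₃)
    (hf : Function.Injective f) (hg : Function.Surjective g) (hfg : Function.Exact f g) :
    Module.length R (N₂ →ₗ[R] M) =
      Module.length R (N₁ →ₗ[R] M) + Module.length R (N₃ →ₗ[R] M) := by
  rw [add_comm]
  refine Module.length_eq_add_of_exact (LinearMap.lcomp R M g) (LinearMap.lcomp R M f)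
    (LinearMap.lcomp_injective_of_surjective g hg) (fun a ↦ ?_)
    (LinearMap.exact_lcomp_of_exact_of_surjective M hfg hg)
  have hS := ModuleCat.shortExact_of_exact f g hf hg hfg
  have := hvan N₃
  obtain ⟨β, hβ⟩ := Ext.contravariant_sequence_exact₁ hS (ModuleCat.of R M)
    (Ext.mk₀ (ModuleCat.ofHom a)) (add_zero 1) (this.elim _ _)
  obtain ⟨b, rfl⟩ := (Ext.mk₀_bijective _ _).2 β
  rw [Ext.mk₀_comp_mk₀] at hβ
  refine ⟨b.hom, ?_⟩
  exact congrArg ModuleCat.Hom.hom ((Ext.mk₀_bijective _ _).1 hβ)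

variable [IsLocalRing R]

/-- `Hom(k, M)` is finitely generated over `R` and killed by `𝔪`, so it is a finite-dimensional
vector space over the residue field. -/
theorem length_linearMap_residueField_ne_top [IsNoetherianRing R] [Module.Finite R M] :
    Module.length R (ResidueField R →ₗ[R] M) ≠ ⊤ := by
  have htors : Module.IsTorsionBySet R (ResidueField R →ₗ[R] M) (maximalIdeal R : Set R) := by
    rintro f ⟨a, ha⟩
    ext x
    have hax : a • x = 0 := by
      rw [Algebra.smul_def, ResidueField.algebraMap_eq, (residue_eq_zero_iff a).mpr ha, zero_mul]
    change a • f x = 0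
    rw [← map_smul, hax, map_zero]
  let : Module (R ⧸ maximalIdeal R) (ResidueField R →ₗ[R] M) := htors.module
  have : IsScalarTower R (R ⧸ maximalIdeal R) (ResidueField R →ₗ[R] M) := htors.isScalarTower
  let : Field (R ⧸ maximalIdeal R) := Ideal.Quotient.field _
  have : Module.Finite (R ⧸ maximalIdeal R) (ResidueField R →ₗ[R] M) :=
    Module.Finite.of_restrictScalars_finite R _ _
  rw [Module.length_eq_of_surjective (S := R) (R := R ⧸ maximalIdeal R)
    Ideal.Quotient.mk_surjective]
  exact Module.length_ne_top

theorem length_linearMap_ne_top [IsNoetherianRing R] [Module.Finite R M]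
    (hvan : ∀ (N : Type u) [AddCommGroup N] [Module R N] [Module.Finite R N],
      Subsingleton (Ext (ModuleCat.of R N) (ModuleCat.of R M) 1))
    (N : Type u) [AddCommGroup N] [Module R N] [Module.Finite R N] :
    Module.length R (N →ₗ[R] M) ≠ ⊤ := by
  induction ‹Module.Finite R N› using
    IsNoetherianRing.induction_on_isQuotientEquivQuotientPrime R with
  | subsingleton N => simp [Module.length_eq_zero]
  | quotient N p e =>
    by_cases hp : p.1 = maximalIdeal R
    · rw [hp] at e
      rw [(LinearEquiv.congrLeft M R e).length_eq]
      exact length_linearMap_residueField_ne_top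
    · have hext := subsingleton_ext_quotient_prime 0 hvan p.1 hp e
      have : Subsingleton (N →ₗ[R] M) :=
        ((Ext.homEquiv₀ (X := ModuleCat.of R N) (Y := ModuleCat.of R M)).trans
          ModuleCat.homEquiv).symm.subsingleton
      simp [Module.length_eq_zero]
  | exact N₁ N₂ N₃ f g hf hg hfg h₁ h₃ =>
    rw [length_linearMap_eq_add hvan f g hf hg hfg]
    exact WithTop.add_ne_top.mpr ⟨h₁, h₃⟩

theorem length_linearMap_eq_mul [IsArtinianRing R]
    (hvan : ∀ (N : Type u) [AddCommGroup N] [Module R N] [Module.Finite R N],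
      Subsingleton (Ext (ModuleCat.of R N) (ModuleCat.of R M) 1))
    (N : Type u) [AddCommGroup N] [Module R N] [Module.Finite R N] :
    Module.length R (N →ₗ[R] M) =
      Module.length R N * Module.length R (ResidueField R →ₗ[R] M) := by
  induction ‹Module.Finite R N› using
    IsNoetherianRing.induction_on_isQuotientEquivQuotientPrime R with
  | subsingleton N => simp [Module.length_eq_zero]
  | quotient N p e =>
    rw [eq_maximalIdeal (IsArtinianRing.isMaximal_of_isPrime p.1)] at e
    have : IsSimpleModule R N :=
      isSimpleModule_iff_quot_maximal.mpr ⟨_, maximalIdeal.isMaximal R, ⟨e⟩⟩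
    rw [(LinearEquiv.congrLeft M R e).length_eq, Module.length_eq_one R N, one_mul]
    rfl
  | exact N₁ N₂ N₃ f g hf hg hfg h₁ h₃ =>
    rw [length_linearMap_eq_add hvan f g hf hg hfg, h₁, h₃,
      Module.length_eq_add_of_exact f g hf hg hfg, add_mul]

end Length

theorem mainTheorem7 (R : Type u) [CommRing R] [IsLocalRing R] [IsNoetherianRing R]
    (M : Type u) [AddCommGroup M] [Module R M] [Module.Finite R M]
    (m : ℕ) (hm : 0 < m) (φ : (Fin m → R) →ₗ[R] M)
    (hirr : IsIrreducibleHom φ) (hsurj : Function.Surjective φ)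
    (hid : CategoryTheory.injectiveDimension (ModuleCat.of R M) < ⊤) :
    IsField R := by
  have hsimple := hirr.isSimpleModule_ker hsurj
  obtain ⟨n, hn⟩ := (injectiveDimension_ne_top_iff _).mp hid.ne
  have hvan (N : Type u) [AddCommGroup N] [Module R N] [Module.Finite R N] :
      Subsingleton (Ext (ModuleCat.of R N) (ModuleCat.of R M) 1) :=
    subsingleton_ext_succ_of_hasInjectiveDimensionLT hsurj (n + 1) hn 0 N
  have hself : Module.length R (R →ₗ[R] M) = Module.length R M :=
    (LinearMap.ringLmapEquivSelf R R M).length_eq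
  have hM : Module.length R M ≠ ⊤ := hself ▸ length_linearMap_ne_top hvan R
  have hlen : m * Module.length R R = 1 + Module.length R M := by
    rw [← Module.length_eq_one R (LinearMap.ker φ),
      ← Module.length_eq_add_of_exact (LinearMap.ker φ).subtype φ
        (Submodule.injective_subtype _) hsurj (LinearMap.exact_subtype_ker_map φ)]
    simp
  have hR : Module.length R R ≠ ⊤ := by
    intro h
    rw [h, ENat.mul_top (by exact_mod_cast hm.ne')] at hlen
    exact WithTop.add_ne_top.mpr ⟨ENat.one_ne_top, hM⟩ hlen.symm
  have hart : IsArtinianRing R :=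
    (isFiniteLength_iff_isNoetherian_isArtinian.mp (Module.length_ne_top_iff.mp hR)).2
  have hr := length_linearMap_residueField_ne_top (R := R) (M := M)
  rw [← hself, length_linearMap_eq_mul hvan R] at hlen
  obtain ⟨l, hl⟩ := ENat.ne_top_iff_exists.mp hR
  obtain ⟨r, hr⟩ := ENat.ne_top_iff_exists.mp hr
  rw [← hl, ← hr] at hlen
  norm_cast at hlen
  have hl1 : l ∣ 1 :=
    (Nat.dvd_add_left (Dvd.intro r rfl)).mp (hlen ▸ Dvd.intro_left m rfl)
  have hone : Module.length R R = 1 := by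
    rw [← hl, Nat.dvd_one.mp hl1, Nat.cast_one]
  rw [Ring.isField_iff_isSimpleOrder_ideal]
  exact (isSimpleModule_iff R R).mp (Module.length_eq_one_iff.mp hone)
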